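/- Let $N\ge 2$. For a formal power series $h$, let $\bar h$ denote the series obtained by conjugating its coefficients. A formal real hypersurface $M\subset\mathbb{C}^N$ through the origin is given by a power series $r(Z,\zeta)\in\mathbb{C}[[Z,\zeta]]$, $(Z,\zeta)\in\mathbb{C}^N\times\mathbb{C}^N$, with $\bar r(\zeta,Z)=r(Z,\zeta)$, $r(0)=0$ and $\partial_Z r(0)\neq 0$; let $\mathcal{I}(M)$ be the ideal generated by $r$, and $T^{1,0}_0M=\ker \partial_Z r(0)\subset\mathbb{C}^N$. $M$ belongs to the class $\mathcal{C}$ if, in normal coordinates $Z=Z(z,w)$ for $M$, $(z,w)\in\mathbb{C}^{N-1}\times\mathbb{C}$ (that is, a formal change of coordinates at $0$ such that $r\big(Z(z,w),\bar Z(\chi,\tau)\big)$ generates the same ideal of $\mathbb{C}[[z,w,\chi,\tau]]$ as $w-Q(z,\chi,\tau)$, where $Q(0,\chi,\tau)=Q(z,0,\tau)=\tau$), for all sufficiently large $k$ the Jacobian matrix of the formal map $\chi\mapsto \big(Q_{z^\alpha}(0,\chi,0)\big)_{|\alpha|\le k}$ has rank $N-1$ over $\mathbb{C}[[\chi]]$.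 A formal real hypersurface $M'$ given by $r'$ contains a formal curve if there is a nonconstant formal holomorphic map $\gamma\colon(\mathbb{C},0)\to(\mathbb{C}^N,0)$ such that $r'(\gamma(t),\bar\gamma(s))=0$ in $\mathbb{C}[[t,s]]$. A formal holomorphic map $H\colon(\mathbb{C}^N,0)\to(\mathbb{C}^N,0)$ sends $M$ into $M'$ if $h(H(Z),\bar H(\zeta))\in\mathcal{I}(M)$ for every $h\in\mathcal{I}(M')$; it is CR-transversal if $T^{1,0}_0M'+dH(T_0\mathbb{C}^N)=T_0\mathbb{C}^N$, where $dH$ is the differential of $H$ at $0$. Let $M,M'\subset\mathbb{C}^N$ be formal real hypersurfaces such that $M$ belongs to the class $\mathcal{C}$ and $M'$ contains no formal curve. Then every formal holomorphic map $H\colon(\mathbb{C}^N,0)\to(\mathbb{C}^N,0)$ sending $M$ into $M'$ is either constant or CR-transversal. -/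

import Mathlib

noncomputable section

namespace FormalCR

/-- The formal power series `h̄` obtained by conjugating the coefficients of `h`. -/
def conjSeries {σ : Type} (h : MvPowerSeries σ ℂ) : MvPowerSeries σ ℂ :=
  MvPowerSeries.map (starRingEnd ℂ) h

/-- A formal (holomorphic) map `(ℂ^σ, 0) → (ℂ^τ, 0)`: one power series in the variables `σ`
without constant term for each coordinate `j : τ` of the target. -/
structure FormalMap (σ τ : Type) where
  comp : τ → MvPowerSeries σ ℂ
  constantCoeff_comp : ∀ j, MvPowerSeries.constantCoeff (comp j) = 0

namespace FormalMap

/-- The composition `h ∘ F` of a power series `h` on the target with a formal map `F`. -/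
def pull {σ τ : Type} (F : FormalMap σ τ) (h : MvPowerSeries τ ℂ) : MvPowerSeries σ ℂ :=
  MvPowerSeries.subst F.comp h

/-- The pushforward `F_*(I) = {h | h ∘ F ∈ I}` of an ideal (as a set of power series). -/
def pushforward {σ τ : Type} (F : FormalMap σ τ) (I : Ideal (MvPowerSeries σ ℂ)) :
    Set (MvPowerSeries τ ℂ) :=
  {h | F.pull h ∈ I}

/-- The map `(Z, ζ) ↦ (F(Z), F̄(ζ))`. The variables `Z` are indexed by `Sum.inl`, the
variables `ζ` by `Sum.inr`. -/
def doubled {σ τ : Type} [Finite σ] (F : FormalMap σ τ) : FormalMap (σ ⊕ σ) (τ ⊕ τ) where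
  comp := Sum.elim
    (fun j => MvPowerSeries.rename Sum.inl (F.comp j))
    (fun j => MvPowerSeries.rename Sum.inr (conjSeries (F.comp j)))
  constantCoeff_comp := by
    rintro (j | j)
    · simp [F.constantCoeff_comp j]
    · simp [conjSeries, F.constantCoeff_comp j]

/-- The differential `dF` at `0`, as a complex matrix. -/
def diffZero {σ τ : Type} (F : FormalMap σ τ) : Matrix τ σ ℂ :=
  Matrix.of fun j i => MvPowerSeries.constantCoeff (MvPowerSeries.pderiv ℂ i (F.comp j))

/-- A constant formal map. -/
def IsConstant {σ τ : Type} (F : FormalMap σ τ) : Prop :=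
  ∃ c : τ → ℂ, ∀ j, F.comp j = MvPowerSeries.C (c j)

end FormalMap

/-- The generic rank of a (possibly not base point preserving) family of power series `F` in
finitely many variables: the rank of the Jacobian matrix `∂F/∂x`, regarded as a linear map
over the ring of formal power series. -/
def genericRank {σ κ : Type} [Fintype σ] (F : κ → MvPowerSeries σ ℂ) : ℕ :=
  Matrix.rank (Matrix.of fun (j : κ) (i : σ) => MvPowerSeries.pderiv ℂ i (F j))

/-- A formal real hypersurface `M ⊂ ℂ^N` through the origin, given by a defining series
`r(Z, ζ)` (`Z` indexed by `Sum.inl`, `ζ` by `Sum.inr`). -/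
structure FormalHypersurface (N : ℕ) where
  r : MvPowerSeries (Fin N ⊕ Fin N) ℂ
  /-- invariance under the involution `f(Z, ζ) ↦ f̄(ζ, Z)` -/
  invariant : MvPowerSeries.rename Sum.swap (conjSeries r) = r
  /-- `r(0) = 0` -/
  constantCoeff_r : MvPowerSeries.constantCoeff r = 0
  /-- the gradient of `r` with respect to `Z` does not vanish at `0` -/
  gradient_ne_zero :
    ∃ i : Fin N, MvPowerSeries.constantCoeff (MvPowerSeries.pderiv ℂ (Sum.inl i) r) ≠ 0

namespace FormalHypersurface

/-- The ideal `ℐ(M)` generated by the defining series. -/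
def ideal {N : ℕ} (M : FormalHypersurface N) : Ideal (MvPowerSeries (Fin N ⊕ Fin N) ℂ) :=
  Ideal.span {M.r}

/-- `T_0^{1,0} M`, the kernel of the complex linear form `∂_Z r(0)` on `T_0 ℂ^N = ℂ^N`. -/
def tangentOneZero {N : ℕ} (M : FormalHypersurface N) : Submodule ℂ (Fin N → ℂ) :=
  LinearMap.ker (∑ i : Fin N,
    MvPowerSeries.constantCoeff (MvPowerSeries.pderiv ℂ (Sum.inl i) M.r) •
      (LinearMap.proj i : (Fin N → ℂ) →ₗ[ℂ] ℂ))

/-- `M` contains a formal curve: there is a nonconstant formal holomorphic map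
`γ : (ℂ, 0) → (ℂ^N, 0)` with `r(γ(t), γ̄(τ)) = 0` as a power series in `(t, τ)`. -/
def ContainsFormalCurve {N : ℕ} (M : FormalHypersurface N) : Prop :=
  ∃ γ : FormalMap Unit (Fin N), ¬ γ.IsConstant ∧ γ.doubled.pull M.r = 0

end FormalHypersurface

/-- `H` sends `M` into `M'`: `ℐ(M') ⊆ ℋ_*(ℐ(M))` with `ℋ(Z, ζ) = (H(Z), H̄(ζ))`. -/
def SendsInto {N : ℕ} (H : FormalMap (Fin N) (Fin N)) (M M' : FormalHypersurface N) : Prop :=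
  (M'.ideal : Set (MvPowerSeries (Fin N ⊕ Fin N) ℂ)) ⊆ H.doubled.pushforward M.ideal

/-- CR-transversality of `H` with respect to the target hypersurface `M'`:
`T_0^{1,0} M' + dH(T_0 ℂ^N) = T_0 ℂ^N`. -/
def IsCRTransversal {N : ℕ} (H : FormalMap (Fin N) (Fin N)) (M' : FormalHypersurface N) : Prop :=
  M'.tangentOneZero ⊔ LinearMap.range H.diffZero.mulVecLin = ⊤

/-! ### Normal coordinates in `ℂ^(n+1)`

The coordinates are `(z, w)` with `z` indexed by `Fin.castSucc i`, `i : Fin n`, and `w` by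
`Fin.last n`; likewise `ζ = (χ, τ)`. A series `Q(z, χ, τ)` has the variables `z` indexed by
`Sum.inl` and the variables `(χ, τ)` indexed by `Sum.inr`. -/

/-- `w - Q(z, χ, τ)` as a power series in `((z, w), (χ, τ))`. -/
def graphSeries {n : ℕ} (Q : MvPowerSeries (Fin n ⊕ Fin (n + 1)) ℂ) :
    MvPowerSeries (Fin (n + 1) ⊕ Fin (n + 1)) ℂ :=
  MvPowerSeries.X (Sum.inl (Fin.last n)) -
    MvPowerSeries.rename (Sum.map Fin.castSucc id) Q

/-- The substitution `z = 0`, giving `Q(0, χ, τ)`. -/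
def evalZZero {n : ℕ} (Q : MvPowerSeries (Fin n ⊕ Fin (n + 1)) ℂ) :
    MvPowerSeries (Fin n ⊕ Fin (n + 1)) ℂ :=
  MvPowerSeries.subst
    (Sum.elim (fun _ : Fin n => (0 : MvPowerSeries (Fin n ⊕ Fin (n + 1)) ℂ))
      (fun j : Fin (n + 1) => MvPowerSeries.X (Sum.inr j))) Q

/-- The substitution `χ = 0`, giving `Q(z, 0, τ)`. -/
def evalChiZero {n : ℕ} (Q : MvPowerSeries (Fin n ⊕ Fin (n + 1)) ℂ) :
    MvPowerSeries (Fin n ⊕ Fin (n + 1)) ℂ :=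
  MvPowerSeries.subst
    (Sum.elim
      (fun i : Fin n =>
        (MvPowerSeries.X (Sum.inl i) : MvPowerSeries (Fin n ⊕ Fin (n + 1)) ℂ))
      (fun j : Fin (n + 1) =>
        if j = Fin.last n then MvPowerSeries.X (Sum.inr (Fin.last n)) else 0)) Q

/-- `Φ : (z, w) ↦ Z` is a formal change of coordinates of `ℂ^(n+1)` which provides normal
coordinates for `M`, in which `M` is defined by `w = Q(z, χ, τ)`. -/
structure IsNormalCoordinates {n : ℕ} (M : FormalHypersurface (n + 1))
    (Φ : FormalMap (Fin (n + 1)) (Fin (n + 1)))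
    (Q : MvPowerSeries (Fin n ⊕ Fin (n + 1)) ℂ) : Prop where
  /-- `Φ` is invertible -/
  det_ne_zero : Φ.diffZero.det ≠ 0
  /-- in the new coordinates `(Z, ζ) = (Φ(z, w), Φ̄(χ, τ))`, the ideal of `M` is generated
  by `w - Q(z, χ, τ)` -/
  ideal_eq : Ideal.span {Φ.doubled.pull M.r} = Ideal.span {graphSeries Q}
  /-- `Q(0, χ, τ) = τ` -/
  normal_z : evalZZero Q = MvPowerSeries.X (Sum.inr (Fin.last n))
  /-- `Q(z, 0, τ) = τ` -/
  normal_chi : evalChiZero Q = MvPowerSeries.X (Sum.inr (Fin.last n))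

/-- The series `Q_{z^α}(0, χ, 0)` in the variables `χ`: its coefficient at `χ^β` is `α!` times
the coefficient of `z^α χ^β τ^0` in `Q(z, χ, τ)`. -/
def derivSeries {n : ℕ} (Q : MvPowerSeries (Fin n ⊕ Fin (n + 1)) ℂ) (α : Fin n →₀ ℕ) :
    MvPowerSeries (Fin n) ℂ :=
  fun β => (∏ i : Fin n, (Nat.factorial (α i) : ℂ)) *
    MvPowerSeries.coeff (Finsupp.sumElim α (β.mapDomain Fin.castSucc)) Q

/-- `M ⊂ ℂ^(n+1)` belongs to the class `𝒞`: in normal coordinates, for `k` large enough, the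
formal map `χ ↦ (Q_{z^α}(0, χ, 0))_{|α| ≤ k}` has generic rank `n`. -/
def InClassC {n : ℕ} (M : FormalHypersurface (n + 1)) : Prop :=
  ∃ (Φ : FormalMap (Fin (n + 1)) (Fin (n + 1))) (Q : MvPowerSeries (Fin n ⊕ Fin (n + 1)) ℂ),
    IsNormalCoordinates M Φ Q ∧
      ∃ k₀ : ℕ, ∀ k ≥ k₀,
        genericRank (fun α : {α : Fin n →₀ ℕ // α.degree ≤ k} => derivSeries Q α.1) = n

end FormalCR

end

/-! In normal coordinates put ρ = w - Q. That H sends M into M' means r'(H(Z), H̄(ζ)) = a ρ for some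
series a. Taking the w-derivative at 0 shows that a(0) ≠ 0 forces CR-transversality. Class 𝒞 enters
in one form only: no nonzero vector field in ζ with coefficients depending on ζ alone annihilates Q
(`eq_zero_of_sum`, and `eq_zero_of_sum_dropTau` on τ = 0).

Suppose det ∂H = 0. A kernel vector of the conjugate Jacobian is a vector field in ζ annihilating
r'(H, H̄), a series that vanishes on w = Q. The vector field is transversal enough to w = Q to force
all w-derivatives to vanish there too, so r'(H, H̄) = 0 identically (`eq_zero_of_vectorField`). If H
were not constant, it would map some line to a nonconstant curve in M'.

Suppose det ∂H ≠ 0. Differentiate r'(H, H̄) = a ρ and restrict to τ = 0, w = Q(z, χ, 0). The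
Z-derivatives give a ≠ 0 there; the ζ-derivatives and class 𝒞 then give det ∂H̄(χ, 0) ≠ 0;
conjugating and setting χ = 0 gives a(z, 0) ≠ 0. By Cramer's rule a(z, χ) divides a unit times det
∂H̄(χ, 0), a series in χ alone, and together these force a(0) ≠ 0
(`constantCoeff_ne_zero_of_mul_eq_rename`).

Formal identity principles are all reduced to `eq_zero_of_pderiv_closed`. -/

open MvPowerSeries

/-! ### Power series: chain rule, setting variables to zero, nonvanishing criteria. -/

namespace MvPowerSeries


variable {σ τ : Type*} {R : Type*} [CommRing R]

theorem exists_coeff_ne_zero {f : MvPowerSeries σ R} (hf : f ≠ 0) : ∃ n, coeff n f ≠ 0 := by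
  contrapose! hf
  exact MvPowerSeries.ext hf

theorem pderiv_comm (i j : σ) (f : MvPowerSeries σ R) :
    pderiv R i (pderiv R j f) = pderiv R j (pderiv R i f) := by
  classical
  ext n
  simp only [coeff_pderiv, Finsupp.add_apply, add_right_comm n (Finsupp.single i 1)]
  by_cases h : i = j
  · subst h; ring
  · simp [h, Ne.symm h]; ring

/-- A set of power series with vanishing constant terms that is stable under all partial
derivatives contains only `0`. -/
theorem eq_zero_of_pderiv_closed [IsAddTorsionFree R] (V : MvPowerSeries σ R → Prop)
    (h0 : ∀ f, V f → constantCoeff f = 0) (hd : ∀ f, V f → ∀ i, V (pderiv R i f))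
    {f : MvPowerSeries σ R} (hf : V f) : f = 0 := by
  suffices ∀ m : ℕ, ∀ f, V f → ∀ n : σ →₀ ℕ, n.degree = m → coeff n f = 0 by
    ext n; exact this _ f hf n rfl
  intro m
  induction m with
  | zero =>
    intro f hf n hn
    rw [(Finsupp.degree_eq_zero_iff n).mp hn]
    exact h0 f hf
  | succ m ih =>
    intro f hf n hn
    have hn0 : n ≠ 0 := by rintro rfl; simp at hn
    obtain ⟨i, hi⟩ := Finsupp.ne_iff.mp hn0
    have hle : Finsupp.single i 1 ≤ n := by
      rw [Finsupp.single_le_iff]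
      exact Nat.one_le_iff_ne_zero.mpr hi
    have hdeg : (n - Finsupp.single i 1).degree = m := by
      have : (n - Finsupp.single i 1 + Finsupp.single i 1).degree = m + 1 := by
        rw [tsub_add_cancel_of_le hle, hn]
      rw [map_add, Finsupp.degree_single] at this
      omega
    have e := ih _ (hd f hf i) _ hdeg
    rw [coeff_pderiv, tsub_add_cancel_of_le hle] at e
    have e' : ((n - Finsupp.single i 1 : σ →₀ ℕ) i + 1) • coeff n f = 0 := by
      rw [nsmul_eq_mul, mul_comm]; exact_mod_cast e
    exact (nsmul_eq_zero_iff_right (Nat.succ_ne_zero _)).mp e'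

open scoped WithPiTopology in
theorem continuous_pderiv [TopologicalSpace R] [IsTopologicalRing R] (i : σ) :
    Continuous (pderiv R i : MvPowerSeries σ R → MvPowerSeries σ R) := by
  refine continuous_pi fun n => ?_
  have : (fun f : MvPowerSeries σ R => (pderiv R i f) n) =
      fun f => coeff (n + Finsupp.single i 1) f * ((n i : R) + 1) := by
    ext f; exact coeff_pderiv f n
  rw [this]
  exact (WithPiTopology.continuous_coeff R _).mul continuous_const

theorem pderiv_subst_coe [Fintype σ] {a : σ → MvPowerSeries τ R} (ha : HasSubst a)
    (p : MvPolynomial σ R) (i : τ) :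
    pderiv R i (subst a (p : MvPowerSeries σ R)) =
      ∑ j, subst a (pderiv R j (p : MvPowerSeries σ R)) * pderiv R i (a j) := by
  classical
  obtain ⟨φ, hφ⟩ : ∃ φ : MvPowerSeries σ R →ₐ[R] MvPowerSeries τ R, ∀ f, subst a f = φ f :=
    ⟨substAlgHom ha, fun f => (substAlgHom_apply ha f).symm⟩
  have hX : ∀ k, φ (X k) = a k := fun k => by rw [← hφ, subst_X ha]
  simp only [hφ]
  induction p using MvPolynomial.induction_on with
  | C r =>
    have h : φ (C r : MvPowerSeries σ R) = C r := φ.commutes r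
    simp [h]
  | add p q hp hq => simp [hp, hq, add_mul, Finset.sum_add_distrib]
  | mul_X p k hp =>
    simp only [MvPolynomial.coe_mul, MvPolynomial.coe_X, map_mul, Derivation.leibniz, hp,
      smul_eq_mul, map_add, add_mul, Finset.sum_add_distrib, hX, Finset.mul_sum]
    congr 1
    · rw [Finset.sum_eq_single k]
      · simp
      · intro j _ hj; simp [hj.symm]
      · simp
    · exact Finset.sum_congr rfl fun j _ => by ring

open scoped WithPiTopology in
/-- The chain rule for substitution of power series. -/
theorem pderiv_subst [Fintype σ] {a : σ → MvPowerSeries τ R} (ha : HasSubst a)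
    (f : MvPowerSeries σ R) (i : τ) :
    pderiv R i (subst a f) = ∑ j, subst a (pderiv R j f) * pderiv R i (a j) := by
  -- With the discrete topology on R both sides are continuous in f, so density of the polynomials
  -- reduces the claim to `pderiv_subst_coe`.
  let : UniformSpace R := ⊥
  have : DiscreteUniformity R := ⟨rfl⟩
  have hs := continuous_subst (R := R) ha
  refine congrFun (WithPiTopology.denseRange_toMvPowerSeries.equalizer
    (g := fun f : MvPowerSeries σ R => pderiv R i (subst a f))
    (h := fun f => ∑ j, subst a (pderiv R j f) * pderiv R i (a j)) ?_ ?_ ?_) f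
  · exact (continuous_pderiv i).comp hs
  · exact continuous_finsetSum _ fun j _ =>
      (hs.comp (continuous_pderiv j)).mul continuous_const
  · funext p; exact pderiv_subst_coe ha p i

theorem pderiv_rename [Fintype σ] (e : σ ↪ τ) (f : MvPowerSeries σ R) (i : σ) :
    pderiv R (e i) (rename e f) = rename e (pderiv R i f) := by
  simp only [rename_eq_subst]
  rw [pderiv_subst (HasSubst.X_comp e), Finset.sum_eq_single i]
  · simp
  · intro j _ hj
    simp [pderiv_X_of_ne (R := R) (e.injective.ne hj)]
  · simp

theorem pderiv_rename_of_notMem [Fintype σ] (e : σ ↪ τ) (f : MvPowerSeries σ R) {i : τ}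
    (hi : i ∉ Set.range e) : pderiv R i (rename e f) = 0 := by
  rw [rename_eq_subst, pderiv_subst (HasSubst.X_comp e)]
  refine Finset.sum_eq_zero fun j _ => ?_
  simp [pderiv_X_of_ne (R := R) (i := i) (j := e j) fun h => hi ⟨j, h⟩]

theorem pderiv_killCompl (e : σ ↪ τ) (f : MvPowerSeries τ R) (i : σ) :
    pderiv R i (killCompl e f) = killCompl e (pderiv R (e i) f) := by
  ext n
  simp [coeff_pderiv, coeff_killCompl, Finsupp.embDomain_add, Finsupp.embDomain_single]

@[simp]
theorem constantCoeff_killCompl (e : σ ↪ τ) (f : MvPowerSeries τ R) :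
    constantCoeff (killCompl e f) = constantCoeff f := by
  rw [← coeff_zero_eq_constantCoeff_apply, ← coeff_zero_eq_constantCoeff_apply, coeff_killCompl,
    Finsupp.embDomain_zero]

theorem killCompl_killCompl {υ : Type*} (d : υ ↪ σ) (e : σ ↪ τ) (f : MvPowerSeries τ R) :
    killCompl d (killCompl e f) = killCompl (d.trans e) f := by
  ext n
  simp [coeff_killCompl, Finsupp.embDomain_trans_apply]

theorem map_pderiv {S : Type*} [CommRing S] (φ : R →+* S) (f : MvPowerSeries σ R) (i : σ) :
    map φ (pderiv R i f) = pderiv S i (map φ f) := by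
  ext n
  simp [coeff_pderiv]

theorem constantCoeff_subst_of_zero [Finite σ] {a : σ → MvPowerSeries τ R}
    (ha : ∀ i, constantCoeff (a i) = 0) (f : MvPowerSeries σ R) :
    constantCoeff (subst a f) = constantCoeff f := by
  have hs := hasSubst_of_constantCoeff_zero ha
  have h := constantCoeff_subst_eq_zero hs ha (f := f - C (constantCoeff f)) (by simp)
  have hC : subst a (C (constantCoeff f) : MvPowerSeries σ R) = C (constantCoeff f) := by
    rw [← coe_substAlgHom hs]; exact (substAlgHom hs).commutes _
  rw [subst_sub hs, hC, map_sub, constantCoeff_C, sub_eq_zero] at h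
  exact h

theorem hasSubst_killCompl_X [Finite τ] (e : σ ↪ τ) :
    HasSubst fun t => killCompl (R := R) e (X t) :=
  hasSubst_of_constantCoeff_zero fun t => by simp

/-- As f varies, the differences of the two sides have zero constant term and are stable under
derivatives, so `eq_zero_of_pderiv_closed` applies. -/
theorem killCompl_eq_subst [IsAddTorsionFree R] [Fintype τ] (e : σ ↪ τ) (f : MvPowerSeries τ R) :
    killCompl e f = subst (fun t => killCompl (R := R) e (X t)) f := by
  classical
  have hs := hasSubst_killCompl_X (R := R) e
  rw [← sub_eq_zero]
  refine eq_zero_of_pderiv_closed (fun g => ∃ f : MvPowerSeries τ R,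
    g = killCompl e f - subst (fun t => killCompl (R := R) e (X t)) f) ?_ ?_ ⟨f, rfl⟩
  · rintro _ ⟨f, rfl⟩
    rw [map_sub, constantCoeff_killCompl, constantCoeff_subst_of_zero (fun t => by simp), sub_self]
  · rintro _ ⟨f, rfl⟩ i
    refine ⟨pderiv R (e i) f, ?_⟩
    rw [map_sub, pderiv_killCompl, pderiv_subst hs, Finset.sum_eq_single (e i)]
    · simp
    · intro j _ hj
      rw [pderiv_killCompl, pderiv_X_of_ne hj, map_zero, mul_zero]
    · simp

/-- Substituting variables or zeros compatibly with `killCompl e` does not affect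
`killCompl e`. -/
theorem killCompl_subst [IsAddTorsionFree R] {υ : Type*} [Fintype τ] [Fintype υ] (e : σ ↪ τ)
    (d : σ ↪ υ) {a : τ → MvPowerSeries υ R} (ha : HasSubst a)
    (h : ∀ t, killCompl d (a t) = killCompl e (X t)) (f : MvPowerSeries τ R) :
    killCompl d (subst a f) = killCompl e f := by
  rw [killCompl_eq_subst, subst_comp_subst_apply ha (hasSubst_killCompl_X d), killCompl_eq_subst e]
  simp only [← killCompl_eq_subst, h]

@[simp]
theorem killCompl_inr_rename_inr [Finite τ] (f : MvPowerSeries τ R) :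
    killCompl (.inr : τ ↪ σ ⊕ τ) (rename Sum.inr f) = f :=
  killCompl_rename_app (e := .inr) f

/-- Lexicographic orders add under multiplication. Let x be the variables from d and y those from e,
with y compared first. The order of f has no x-part because the right side has none, and no y-part
because f contains a monomial in x alone; hence it is 0. -/
theorem constantCoeff_ne_zero_of_mul_eq_rename_of_lt {ι : Type*} [Finite ι] [LinearOrder ι]
    [NoZeroDivisors R] [Finite τ] (d : σ ↪ ι) (e : τ ↪ ι) (hlt : ∀ i j, e j < d i)
    (hde : ∀ k, k ∈ Set.range d ∨ k ∈ Set.range e) {f g u : MvPowerSeries ι R}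
    {c : MvPowerSeries τ R} (hc : c ≠ 0) (hu : constantCoeff u ≠ 0)
    (hf : killCompl d f ≠ 0) (h : f * g = u * rename e c) : constantCoeff f ≠ 0 := by
  have hc' : rename e c ≠ 0 := fun h0 => hc (by
    rw [← killCompl_rename_app (e := e) c, h0, map_zero])
  have hu' : lexOrder u = toLex (0 : ι →₀ ℕ) := by
    refine le_antisymm (lexOrder_le_of_coeff_ne_zero hu) ?_
    rw [le_lexOrder_iff]
    intro d hd
    exact absurd (WithTop.coe_lt_coe.mp hd) (not_lt_of_ge bot_le)
  have hu0 : u ≠ 0 := by rintro rfl; simp at hu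
  have hfg : f * g ≠ 0 := by rw [h]; exact mul_ne_zero hu0 hc'
  obtain ⟨a, ha⟩ := exists_finsupp_eq_lexOrder_of_ne_zero (left_ne_zero_of_mul hfg)
  obtain ⟨b, hb⟩ := exists_finsupp_eq_lexOrder_of_ne_zero (right_ne_zero_of_mul hfg)
  obtain ⟨s, hs⟩ := exists_finsupp_eq_lexOrder_of_ne_zero hc'
  have hsum : a + b = s := by
    have := congrArg lexOrder h
    rw [lexOrder_mul, lexOrder_mul, ha, hb, hs, hu', ← WithTop.coe_add, ← WithTop.coe_add,
      WithTop.coe_inj] at this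
    simpa [← toLex_add] using this
  have hne : ∀ i j, e j ≠ d i := fun i j => (hlt i j).ne
  have ha0 : ∀ i, a (d i) = 0 := by
    intro i
    suffices hsi : s (d i) = 0 by
      have := DFunLike.congr_fun hsum (d i)
      rw [hsi, Finsupp.add_apply] at this
      omega
    by_contra hi
    refine coeff_ne_zero_of_lexOrder hs.symm (coeff_rename_eq_zero _ _ ?_)
    rintro ⟨x, rfl⟩
    exact hi (Finsupp.mapDomain_of_notMem_range _ _ (by simp [hne]))
  obtain ⟨x, hx⟩ := exists_coeff_ne_zero hf
  rw [coeff_killCompl] at hx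
  have hx0 : ∀ j, Finsupp.embDomain d x (e j) = 0 := fun j =>
    Finsupp.embDomain_of_notMem_range _ _ _ (by simp [(hne _ _).symm])
  have hle := lexOrder_le_of_coeff_ne_zero hx
  rw [ha, WithTop.coe_le_coe] at hle
  -- The order a is at most the pure x-monomial found above, and the y-exponents are compared before
  -- the x-exponents.
  have ha1 : ∀ j, a (e j) = 0 := by
    rcases hle.eq_or_lt with heq | hl
    · have : a = Finsupp.embDomain d x := heq
      exact fun j => this ▸ hx0 j
    · obtain ⟨k, hk, hk'⟩ := hl
      rcases hde k with ⟨k, rfl⟩ | ⟨k, rfl⟩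
      · exact fun j => (hk _ (hlt k j)).trans (hx0 j)
      · have : a (e k) < Finsupp.embDomain d x (e k) := hk'
        rw [hx0] at this
        omega
  have : a = 0 := by
    ext k
    rcases hde k with ⟨k, rfl⟩ | ⟨k, rfl⟩
    · exact ha0 k
    · exact ha1 k
  subst this
  exact coeff_ne_zero_of_lexOrder ha.symm

/-- If a power series `f` with `f(x, 0) ≠ 0` divides, up to a factor that is a unit, a nonzero
series in the variables `y` only, then `f(0, 0) ≠ 0`. -/
theorem constantCoeff_ne_zero_of_mul_eq_rename [NoZeroDivisors R] {m n : ℕ}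
    {f g u : MvPowerSeries (Fin m ⊕ Fin n) R}
    {c : MvPowerSeries (Fin n) R} (hc : c ≠ 0) (hu : constantCoeff u ≠ 0)
    (hf : killCompl .inl f ≠ 0) (h : f * g = u * rename Sum.inr c) : constantCoeff f ≠ 0 := by
  -- This numbering places the y-variables (`Sum.inr`) before the x-variables (`Sum.inl`).
  have hkey : Function.Injective
      (Sum.elim (fun i => n + i) (fun j => j) : Fin m ⊕ Fin n → ℕ) := by
    rintro (i | i) (j | j) hij <;> simp only [Sum.elim_inl, Sum.elim_inr] at hij
    · exact congrArg _ (Fin.ext (by omega))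
    · omega
    · omega
    · exact congrArg _ (Fin.ext hij)
  refine @constantCoeff_ne_zero_of_mul_eq_rename_of_lt _ _ _ _ _ _ (LinearOrder.lift' _ hkey) _ _
    .inl .inr (fun i j => ?_) (fun k => ?_) f g u c hc hu hf h
  · change (j : ℕ) < n + i
    omega
  · rcases k with k | k
    · exact .inl ⟨k, rfl⟩
    · exact .inr ⟨k, rfl⟩

/-- A nonzero power series over an infinite domain remains nonzero along some line through the
origin. -/
theorem exists_subst_line_ne_zero [IsDomain R] [Infinite R] [Finite σ]
    {f : MvPowerSeries σ R} (hf : f ≠ 0) :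
    ∃ v : σ → R, subst (fun i => v i • (X () : MvPowerSeries Unit R)) f ≠ 0 := by
  classical
  obtain ⟨d₀, hd₀⟩ := exists_coeff_ne_zero hf
  -- Any degree occurring in f serves, not only the lowest: along t ↦ t v the coefficient of t ^ N
  -- is the homogeneous part of degree N evaluated at v.
  set N := d₀.degree with hN
  have hfin : {d : σ →₀ ℕ | d.degree = N}.Finite :=
    (Finsupp.finite_of_degree_le N).subset fun d hd => le_of_eq hd
  let P : MvPolynomial σ R := ∑ d ∈ hfin.toFinset, MvPolynomial.monomial d (coeff d f)
  have hP : P ≠ 0 := by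
    intro h
    have := congrArg (MvPolynomial.coeff d₀) h
    simp [P, MvPolynomial.coeff_sum, MvPolynomial.coeff_monomial] at this
    exact hd₀ (this hN.symm)
  obtain ⟨v, hv⟩ : ∃ v, MvPolynomial.eval v P ≠ 0 := by
    by_contra! h
    exact hP (MvPolynomial.funext fun v => by rw [h v, map_zero])
  refine ⟨v, fun h => hv ?_⟩
  have hs : HasSubst (fun i => v i • (X () : MvPowerSeries Unit R)) :=
    hasSubst_of_constantCoeff_zero fun i => by simp
  have hc := congrArg (coeff (Finsupp.single () N)) h
  rw [coeff_subst hs, map_zero] at hc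
  have hterm : ∀ d : σ →₀ ℕ, coeff (Finsupp.single () N)
      (d.prod fun s e => (v s • (X () : MvPowerSeries Unit R)) ^ e) =
      if d.degree = N then d.prod fun s e => v s ^ e else 0 := by
    intro d
    have : (d.prod fun s e => (v s • (X () : MvPowerSeries Unit R)) ^ e) =
        (d.prod fun s e => v s ^ e) • (X () : MvPowerSeries Unit R) ^ d.degree := by
      simp only [smul_pow, Finsupp.prod, Finset.prod_smul, Finset.prod_pow_eq_pow_sum]
      rfl
    rw [this, map_smul, coeff_X_pow, smul_eq_mul, mul_ite, mul_one, mul_zero]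
    congr 1
    simp [eq_comm]
  simp only [hterm] at hc
  rw [finsum_eq_sum_of_support_subset (s := hfin.toFinset)] at hc
  · simp only [P, map_sum, MvPolynomial.eval_monomial]
    rw [← hc]
    refine Finset.sum_congr rfl fun d hd => ?_
    rw [if_pos (by simpa using hd), smul_eq_mul]
  · intro d hd
    by_contra h
    exact hd (by simp only [Set.Finite.coe_toFinset, Set.mem_ofPred_eq] at h; simp [h])

end MvPowerSeries

/-! ### Composition of formal maps and their Jacobians. -/

namespace FormalCR

namespace FormalMap

variable {σ τ υ : Type}

theorem hasSubst [Finite τ] (F : FormalMap σ τ) : HasSubst F.comp :=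
  hasSubst_of_constantCoeff_zero F.constantCoeff_comp

/-- Composition with a formal map, as an algebra homomorphism. -/
noncomputable def pullHom [Finite τ] (F : FormalMap σ τ) :
    MvPowerSeries τ ℂ →ₐ[ℂ] MvPowerSeries σ ℂ :=
  substAlgHom F.hasSubst

theorem pullHom_apply [Finite τ] (F : FormalMap σ τ) (h : MvPowerSeries τ ℂ) :
    F.pullHom h = F.pull h :=
  substAlgHom_apply F.hasSubst h

@[simp]
theorem pullHom_X [Finite τ] (F : FormalMap σ τ) (j : τ) : F.pullHom (X j) = F.comp j :=
  substAlgHom_X F.hasSubst j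

@[simp]
theorem constantCoeff_pullHom [Finite τ] (F : FormalMap σ τ) (h : MvPowerSeries τ ℂ) :
    constantCoeff (F.pullHom h) = constantCoeff h := by
  rw [pullHom_apply]
  exact constantCoeff_subst_of_zero F.constantCoeff_comp h

/-- The composition `G ∘ F` of formal maps. -/
noncomputable def after [Finite τ] (G : FormalMap τ υ) (F : FormalMap σ τ) : FormalMap σ υ where
  comp j := F.pullHom (G.comp j)
  constantCoeff_comp j := by rw [constantCoeff_pullHom, G.constantCoeff_comp]

theorem pullHom_after [Finite τ] [Finite υ] (G : FormalMap τ υ) (F : FormalMap σ τ)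
    (h : MvPowerSeries υ ℂ) : (G.after F).pullHom h = F.pullHom (G.pullHom h) := by
  simp only [pullHom_apply, pull]
  rw [subst_comp_subst_apply G.hasSubst F.hasSubst]
  simp [after, pullHom_apply, pull]

theorem pullHom_rename {κ : Type} [Finite τ] [Finite κ] (F : FormalMap σ τ) (e : κ → τ)
    (h : MvPowerSeries κ ℂ) :
    F.pullHom (rename e h) = subst (fun k => F.comp (e k)) h := by
  rw [rename_eq_subst, pullHom_apply, pull, subst_comp_subst_apply (HasSubst.X_comp e) F.hasSubst]
  simp only [Function.comp_apply, subst_X F.hasSubst]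

theorem rename_pullHom {κ : Type} [Finite σ] [Finite τ] (F : FormalMap σ τ) (e : σ → κ)
    (h : MvPowerSeries τ ℂ) :
    rename e (F.pullHom h) = subst (fun j => rename e (F.comp j)) h := by
  simp only [rename_eq_subst, pullHom_apply, pull]
  rw [subst_comp_subst_apply F.hasSubst (HasSubst.X_comp e)]

/-- The formal map with conjugated coefficients. -/
noncomputable def conj (F : FormalMap σ τ) : FormalMap σ τ where
  comp j := conjSeries (F.comp j)
  constantCoeff_comp j := by simp [conjSeries, F.constantCoeff_comp j]

theorem conjSeries_pullHom [Finite τ] (F : FormalMap σ τ) (h : MvPowerSeries τ ℂ) :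
    conjSeries (F.pullHom h) = F.conj.pullHom (conjSeries h) := by
  rw [pullHom_apply, pullHom_apply, pull, conjSeries, map_subst F.hasSubst]
  rfl

theorem doubled_pullHom_rename_inl [Finite σ] [Finite τ] (F : FormalMap σ τ)
    (h : MvPowerSeries τ ℂ) :
    F.doubled.pullHom (rename Sum.inl h) = rename Sum.inl (F.pullHom h) := by
  rw [pullHom_rename, rename_pullHom]
  rfl

theorem doubled_pullHom_rename_inr [Finite σ] [Finite τ] (F : FormalMap σ τ)
    (h : MvPowerSeries τ ℂ) :
    F.doubled.pullHom (rename Sum.inr h) = rename Sum.inr (F.conj.pullHom h) := by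
  rw [pullHom_rename, rename_pullHom]
  rfl

theorem doubled_after [Finite σ] [Finite τ] (G : FormalMap τ υ) (F : FormalMap σ τ) :
    (G.after F).doubled = G.doubled.after F.doubled := by
  have : (G.after F).doubled.comp = (G.doubled.after F.doubled).comp := by
    funext j
    rcases j with j | j
    · exact (F.doubled_pullHom_rename_inl (G.comp j)).symm
    · refine Eq.trans ?_ (F.doubled_pullHom_rename_inr (conjSeries (G.comp j))).symm
      rw [← conjSeries_pullHom]
      rfl
  cases h : (G.after F).doubled
  cases h' : G.doubled.after F.doubled
  simp_all

theorem pderiv_pullHom [Fintype τ] (F : FormalMap σ τ) (h : MvPowerSeries τ ℂ) (i : σ) :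
    pderiv ℂ i (F.pullHom h) = ∑ j, F.pullHom (pderiv ℂ j h) * pderiv ℂ i (F.comp j) := by
  simp only [pullHom_apply]
  exact pderiv_subst F.hasSubst h i

/-- Composition with a formal map whose Jacobian matrix has full row rank is injective. -/
theorem pullHom_injective_of_jacobian [Fintype τ] (F : FormalMap σ τ)
    (hF : ∀ v : τ → MvPowerSeries σ ℂ, (∀ i, ∑ j, v j * pderiv ℂ i (F.comp j) = 0) → v = 0)
    {h : MvPowerSeries τ ℂ} (hh : F.pullHom h = 0) : h = 0 := by
  refine eq_zero_of_pderiv_closed (fun h => F.pullHom h = 0) ?_ ?_ hh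
  · intro f hf
    rw [← F.constantCoeff_pullHom, hf, map_zero]
  · intro f hf j
    -- By the chain rule the composed partial derivatives form a left kernel vector of the Jacobian.
    have := hF (fun j => F.pullHom (pderiv ℂ j f)) fun i => by
      rw [← pderiv_pullHom, hf, map_zero]
    exact congrFun this j

/-- The Jacobian matrix of a formal map. -/
noncomputable def jacobian (F : FormalMap σ τ) : Matrix τ σ (MvPowerSeries σ ℂ) :=
  Matrix.of fun j i => pderiv ℂ i (F.comp j)

theorem map_constantCoeff_jacobian (F : FormalMap σ τ) :
    F.jacobian.map constantCoeff = F.diffZero := rfl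

theorem pullHom_injective_of_det_ne_zero [Fintype σ] [DecidableEq σ] (F : FormalMap σ σ)
    (hF : F.diffZero.det ≠ 0) {h : MvPowerSeries σ ℂ} (hh : F.pullHom h = 0) : h = 0 := by
  refine F.pullHom_injective_of_jacobian (fun v hv => ?_) hh
  refine Matrix.eq_zero_of_vecMul_eq_zero (M := F.jacobian) ?_ (funext hv)
  intro h0
  apply hF
  rw [← map_constantCoeff_jacobian, ← RingHom.mapMatrix_apply, ← RingHom.map_det, h0, map_zero]

theorem diffZero_after [Fintype τ] (G : FormalMap τ υ) (F : FormalMap σ τ) :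
    (G.after F).diffZero = G.diffZero * F.diffZero := by
  ext j i
  simp only [diffZero, Matrix.of_apply, Matrix.mul_apply, after, pderiv_pullHom, map_sum, map_mul,
    constantCoeff_pullHom]

theorem isConstant_iff (F : FormalMap σ τ) : F.IsConstant ↔ ∀ j, F.comp j = 0 := by
  constructor
  · rintro ⟨c, hc⟩ j
    have h := F.constantCoeff_comp j
    rw [hc j, constantCoeff_C] at h
    rw [hc j, h, map_zero]
  · exact fun h => ⟨0, fun j => by rw [h j, Pi.zero_apply, map_zero]⟩

/-- The parametrized line `t ↦ t v`. -/
noncomputable def line (v : σ → ℂ) : FormalMap Unit σ where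
  comp i := v i • (X () : MvPowerSeries Unit ℂ)
  constantCoeff_comp i := by simp

end FormalMap

/-- If `r'(H(Z), H̄(ζ)) = 0` identically and `H` is not constant, then the image under `H` of some
line is a nonconstant curve contained in `M'`. -/
theorem FormalHypersurface.containsFormalCurve_of_pullHom_eq_zero {N : ℕ}
    (M' : FormalHypersurface N) (H : FormalMap (Fin N) (Fin N)) (hH : ¬ H.IsConstant)
    (h : H.doubled.pullHom M'.r = 0) : M'.ContainsFormalCurve := by
  rw [FormalMap.isConstant_iff] at hH
  push Not at hH
  obtain ⟨j, hj⟩ := hH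
  obtain ⟨v, hv⟩ := exists_subst_line_ne_zero hj
  refine ⟨H.after (.line v), ?_, ?_⟩
  · rw [FormalMap.isConstant_iff]
    intro h0
    apply hv
    have : (FormalMap.line v).pullHom (H.comp j) = 0 := h0 j
    rwa [FormalMap.pullHom_apply] at this
  · rw [← FormalMap.pullHom_apply, FormalMap.doubled_after, FormalMap.pullHom_after, h, map_zero]

end FormalCR

/-! ### Class 𝒞 as the absence of annihilating vector fields. -/

namespace FormalCR

variable {n : ℕ}

theorem isDomain_mvPowerSeries {σ R : Type*} [CommRing R] [IsDomain R] :
    IsDomain (MvPowerSeries σ R) :=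
  NoZeroDivisors.to_isDomain _

attribute [instance] isDomain_mvPowerSeries

/-- The inclusion of the variables `(z, χ)` into the variables `(z, χ, τ)`. -/
def dropTau (n : ℕ) : Fin n ⊕ Fin n ↪ Fin n ⊕ Fin (n + 1) :=
  (Function.Embedding.refl _).sumMap Fin.castSuccEmb

@[simp] theorem dropTau_inl (i : Fin n) : dropTau n (Sum.inl i) = Sum.inl i := rfl

@[simp] theorem dropTau_inr (i : Fin n) : dropTau n (Sum.inr i) = Sum.inr i.castSucc := rfl

theorem derivSeries_eq (Q : MvPowerSeries (Fin n ⊕ Fin (n + 1)) ℂ) (α β : Fin n →₀ ℕ) :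
    coeff β (derivSeries Q α) = (∏ i : Fin n, (Nat.factorial (α i) : ℂ)) *
      coeff (Finsupp.sumElim α β) (killCompl (dropTau n) Q) := by
  rw [coeff_killCompl]
  have : Finsupp.embDomain (dropTau n) (Finsupp.sumElim α β) =
      Finsupp.sumElim α (β.mapDomain Fin.castSucc) := by
    rw [Finsupp.embDomain_eq_mapDomain]
    ext (k | k)
    · exact Finsupp.mapDomain_apply (dropTau n).injective _ (Sum.inl k)
    · refine Fin.lastCases ?_ (fun k => ?_) k
      · rw [Finsupp.mapDomain_of_notMem_range]
        · simp [Finsupp.mapDomain_of_notMem_range]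
        · rintro ⟨k | k, hk⟩ <;> simp at hk
      · refine (Finsupp.mapDomain_apply (dropTau n).injective _ (Sum.inr k)).trans ?_
        simp [Finsupp.mapDomain_apply (Fin.castSucc_injective n)]
  rw [this]
  rfl

/-- The coefficient of `x ^ α` of a power series in the variables `(x, y)`, as a power series
in `y`. -/
def partialCoeff {σ τ R : Type*} [CommRing R] (α : σ →₀ ℕ) (f : MvPowerSeries (σ ⊕ τ) R) :
    MvPowerSeries τ R :=
  fun γ => coeff (Finsupp.sumElim α γ) f

theorem coeff_partialCoeff {σ τ R : Type*} [CommRing R] (α : σ →₀ ℕ)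
    (f : MvPowerSeries (σ ⊕ τ) R) (β : τ →₀ ℕ) :
    coeff β (partialCoeff α f) = coeff (Finsupp.sumElim α β) f := rfl

/-- A factor in y alone leaves the powers of x untouched, so a relation with coefficients in y can
be tested on each power of x separately. -/
theorem coeff_sumElim_rename_inr_mul {σ τ R : Type*} [CommRing R] [Finite τ]
    (c : MvPowerSeries τ R) (f : MvPowerSeries (σ ⊕ τ) R) (α : σ →₀ ℕ) (β : τ →₀ ℕ) :
    coeff (Finsupp.sumElim α β) (rename Sum.inr c * f) =
      coeff β (c * partialCoeff α f) := by
  classical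
  rw [coeff_mul, coeff_mul]
  symm
  -- Only splittings of the exponent whose first part involves no x contribute.
  refine Finset.sum_of_injOn (fun p => (Finsupp.sumElim 0 p.1, Finsupp.sumElim α p.2)) ?_ ?_ ?_ ?_
  · rintro ⟨p₁, p₂⟩ _ ⟨q₁, q₂⟩ _ h
    simp only [Prod.mk.injEq, DFunLike.ext_iff] at h
    ext k
    · exact h.1 (Sum.inr k)
    · exact h.2 (Sum.inr k)
  · rintro ⟨p₁, p₂⟩ hp
    rw [Finset.mem_coe, Finset.HasAntidiagonal.mem_antidiagonal] at hp ⊢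
    subst hp
    ext (k | k) <;> simp
  · rintro ⟨p, q⟩ hp hpq
    rw [Finset.HasAntidiagonal.mem_antidiagonal] at hp
    refine mul_eq_zero_of_left (coeff_rename_eq_zero _ _ ?_) _
    rintro ⟨x, rfl⟩
    refine hpq ⟨(x, q.comapDomain Sum.inr Sum.inr_injective.injOn), ?_, ?_⟩
    · rw [Finset.mem_coe, Finset.HasAntidiagonal.mem_antidiagonal]
      ext k
      have := DFunLike.congr_fun hp (Sum.inr k)
      rw [Finsupp.add_apply, Finsupp.mapDomain_apply Sum.inr_injective] at this
      simpa using this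
    · refine Prod.ext ?_ ?_
      · ext (k | k)
        · simp [Finsupp.mapDomain_of_notMem_range]
        · simp [Finsupp.mapDomain_apply Sum.inr_injective]
      · ext (k | k)
        · have := DFunLike.congr_fun hp (Sum.inl k)
          rw [Finsupp.add_apply, Finsupp.mapDomain_of_notMem_range _ _ (by simp)] at this
          simpa using this.symm
        · simp
  · rintro ⟨p₁, p₂⟩ _
    rw [coeff_partialCoeff]
    congr 1
    rw [← coeff_embDomain_rename .inr c p₁]
    congr 1
    congr 1
    ext (k | k)
    · simp
    · exact Finsupp.embDomain_apply_self .inr p₁ k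

/-- The inclusion of the variables `(z, χ, τ)` into the variables `(z, w, χ, τ)`. -/
def dropW (n : ℕ) : Fin n ⊕ Fin (n + 1) ↪ Fin (n + 1) ⊕ Fin (n + 1) :=
  Fin.castSuccEmb.sumMap (.refl _)

theorem graphSeries_eq (Q : MvPowerSeries (Fin n ⊕ Fin (n + 1)) ℂ) :
    graphSeries Q = X (Sum.inl (Fin.last n)) - rename (dropW n) Q := rfl

theorem pderiv_graphSeries_dropW (Q : MvPowerSeries (Fin n ⊕ Fin (n + 1)) ℂ)
    (k : Fin n ⊕ Fin (n + 1)) :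
    pderiv ℂ (dropW n k) (graphSeries Q) = -rename (dropW n) (pderiv ℂ k Q) := by
  rw [graphSeries_eq, map_sub, pderiv_rename, pderiv_X_of_ne, zero_sub]
  rcases k with k | k
  · exact fun h => (Fin.castSucc_lt_last k).ne (Sum.inl_injective h).symm
  · exact fun h => nomatch h

theorem pderiv_graphSeries_inl_last (Q : MvPowerSeries (Fin n ⊕ Fin (n + 1)) ℂ) :
    pderiv ℂ (Sum.inl (Fin.last n)) (graphSeries Q) = 1 := by
  rw [graphSeries_eq, map_sub, pderiv_rename_of_notMem, pderiv_X_self, sub_zero]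
  rintro ⟨k | k, hk⟩
  · exact (Fin.castSucc_lt_last k).ne (Sum.inl_injective hk)
  · exact nomatch hk

/-- `Q` is normal and of class `𝒞`. -/
structure IsNondegenerateNormal (Q : MvPowerSeries (Fin n ⊕ Fin (n + 1)) ℂ) : Prop where
  killCompl_inr : killCompl .inr Q = X (Fin.last n)
  killCompl_inl : killCompl .inl Q = 0
  eq_zero : ∀ c : Fin n → MvPowerSeries (Fin n) ℂ,
    ∑ i, rename Sum.inr (c i) * pderiv ℂ (Sum.inr i) (killCompl (dropTau n) Q) = 0 → c = 0

theorem IsNormalCoordinates.killCompl_inr {M : FormalHypersurface (n + 1)}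
    {Φ : FormalMap (Fin (n + 1)) (Fin (n + 1))} {Q : MvPowerSeries (Fin n ⊕ Fin (n + 1)) ℂ}
    (h : IsNormalCoordinates M Φ Q) : killCompl .inr Q = X (Fin.last n) := by
  have := congrArg (killCompl (.inr : Fin (n + 1) ↪ Fin n ⊕ Fin (n + 1))) h.normal_z
  rw [evalZZero, killCompl_subst .inr] at this
  · rw [this]; exact killCompl_X (e := .inr) _
  · exact hasSubst_of_constantCoeff_zero (by rintro (i | i) <;> simp)
  · rintro (i | i)
    · rw [killCompl_X_eq_zero (by simp)]; simp
    · rfl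

theorem IsNormalCoordinates.killCompl_inl {M : FormalHypersurface (n + 1)}
    {Φ : FormalMap (Fin (n + 1)) (Fin (n + 1))} {Q : MvPowerSeries (Fin n ⊕ Fin (n + 1)) ℂ}
    (h : IsNormalCoordinates M Φ Q) : killCompl .inl Q = 0 := by
  have := congrArg (killCompl (.inl : Fin n ↪ Fin n ⊕ Fin (n + 1))) h.normal_chi
  rw [evalChiZero, killCompl_subst .inl] at this
  · rw [this]; exact killCompl_X_eq_zero (by simp)
  · refine hasSubst_of_constantCoeff_zero ?_
    rintro (i | i)
    · simp
    · simp only [Sum.elim_inr]; split_ifs <;> simp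
  · rintro (i | i)
    · rfl
    · rw [killCompl_X_eq_zero (t := Sum.inr i) (by simp)]
      simp only [Sum.elim_inr]
      split_ifs
      · exact killCompl_X_eq_zero (by simp)
      · exact map_zero _

/-- Over a domain, a matrix whose rank is its number of columns has a kernel of rank zero inside a
free module, hence trivial kernel. -/
theorem eq_zero_of_genericRank_eq {σ κ : Type} [Fintype σ] (F : κ → MvPowerSeries σ ℂ)
    (hF : genericRank F = Fintype.card σ) (c : σ → MvPowerSeries σ ℂ)
    (hc : ∀ k, ∑ i, c i * pderiv ℂ i (F k) = 0) : c = 0 := by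
  classical
  set A : Matrix κ σ (MvPowerSeries σ ℂ) := Matrix.of fun j i => pderiv ℂ i (F j) with hA
  have h1 : Module.finrank (MvPowerSeries σ ℂ) (LinearMap.range A.mulVecLin) = Fintype.card σ := hF
  have h2 := Submodule.disjoint_ker_of_finrank_le (L := ⊤) A.mulVecLin (by
    rw [Submodule.map_top, h1, finrank_top, Module.finrank_fintype_fun_eq_card])
  rw [top_disjoint, LinearMap.ker_eq_bot'] at h2
  refine h2 c (funext fun k => ?_)
  rw [Matrix.mulVecLin_apply, Matrix.mulVec, dotProduct, Pi.zero_apply, ← hc k]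
  exact Finset.sum_congr rfl fun i _ => mul_comm _ _

theorem pderiv_partialCoeff {σ τ R : Type*} [CommRing R] (α : σ →₀ ℕ)
    (f : MvPowerSeries (σ ⊕ τ) R) (i : τ) :
    pderiv R i (partialCoeff α f) = partialCoeff α (pderiv R (Sum.inr i) f) := by
  ext β
  have : Finsupp.sumElim α (β + Finsupp.single i 1) =
      Finsupp.sumElim α β + Finsupp.single (Sum.inr i) 1 := by
    classical ext (k | k) <;> simp [Finsupp.single_apply]
  rw [coeff_pderiv, coeff_partialCoeff, coeff_partialCoeff, coeff_pderiv, this, Finsupp.sumElim_inr]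

theorem derivSeries_eq_smul (Q : MvPowerSeries (Fin n ⊕ Fin (n + 1)) ℂ) (α : Fin n →₀ ℕ) :
    derivSeries Q α = (∏ i : Fin n, (Nat.factorial (α i) : ℂ)) •
      partialCoeff α (killCompl (dropTau n) Q) := by
  ext β
  rw [derivSeries_eq, map_smul, coeff_partialCoeff, smul_eq_mul]

/-- The coefficient of z ^ α in ∑ c_i(χ) Q_{χ_i}(z, χ, 0) = 0 says, up to the factor α!, that c
annihilates the row α of the Jacobian in the definition of 𝒞. A single k suffices. -/
theorem exists_isNondegenerateNormal {M : FormalHypersurface (n + 1)} (hM : InClassC M) :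
    ∃ (Φ : FormalMap (Fin (n + 1)) (Fin (n + 1))) (Q : MvPowerSeries (Fin n ⊕ Fin (n + 1)) ℂ),
      IsNormalCoordinates M Φ Q ∧ IsNondegenerateNormal Q := by
  obtain ⟨Φ, Q, hQ, k, hk⟩ := hM
  refine ⟨Φ, Q, hQ, hQ.killCompl_inr, hQ.killCompl_inl, fun c hc => ?_⟩
  refine eq_zero_of_genericRank_eq _ ((hk k le_rfl).trans (Fintype.card_fin n).symm) c fun α => ?_
  simp only [derivSeries_eq_smul, Derivation.map_smul, mul_smul_comm, ← Finset.smul_sum,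
    pderiv_partialCoeff]
  refine smul_eq_zero_of_right _ ?_
  ext β
  have := congrArg (coeff (Finsupp.sumElim α.1 β)) hc
  simpa only [map_sum, coeff_sumElim_rename_inr_mul, map_zero] using this

end FormalCR

namespace MvPowerSeries

variable {σ τ R : Type*} [CommRing R]

theorem pderiv_inl_rename_inl [Fintype σ] (f : MvPowerSeries σ R) (i : σ) :
    pderiv R (Sum.inl i : σ ⊕ τ) (rename Sum.inl f) = rename Sum.inl (pderiv R i f) :=
  pderiv_rename .inl f i

theorem pderiv_inr_rename_inr [Fintype τ] (f : MvPowerSeries τ R) (i : τ) :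
    pderiv R (Sum.inr i : σ ⊕ τ) (rename Sum.inr f) = rename Sum.inr (pderiv R i f) :=
  pderiv_rename .inr f i

theorem pderiv_inr_rename_inl [Fintype σ] (f : MvPowerSeries σ R) (i : τ) :
    pderiv R (Sum.inr i : σ ⊕ τ) (rename Sum.inl f) = 0 :=
  pderiv_rename_of_notMem .inl f (by simp)

theorem pderiv_inl_rename_inr [Fintype τ] (f : MvPowerSeries τ R) (i : σ) :
    pderiv R (Sum.inl i : σ ⊕ τ) (rename Sum.inr f) = 0 :=
  pderiv_rename_of_notMem .inr f (by simp)

end MvPowerSeries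

/-! ### Parametrization of w = Q and spanning by the ζ-gradients of Q. -/

namespace FormalCR

variable {n : ℕ} {Q : MvPowerSeries (Fin n ⊕ Fin (n + 1)) ℂ}

theorem FormalMap.det_jacobian_conj {σ : Type} [Fintype σ] [DecidableEq σ] (F : FormalMap σ σ) :
    F.conj.jacobian.det = conjSeries F.jacobian.det := by
  rw [conjSeries, RingHom.map_det]
  congr 1
  ext1 i j
  exact (map_pderiv _ _ _).symm

/-- The parametrization `(z, χ, τ) ↦ (z, Q(z, χ, τ), χ, τ)` of a hypersurface. -/
noncomputable def graphMap (hQ : constantCoeff Q = 0) :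
    FormalMap (Fin n ⊕ Fin (n + 1)) (Fin (n + 1) ⊕ Fin (n + 1)) where
  comp := Sum.elim (Fin.lastCases Q fun i => X (Sum.inl i)) fun j => X (Sum.inr j)
  constantCoeff_comp := by
    rintro (j | j)
    · refine Fin.lastCases ?_ (fun i => ?_) j
      · simpa using hQ
      · simp
    · simp

section graphMap

variable (hQ : constantCoeff Q = 0)

@[simp]
theorem graphMap_comp_dropW (k : Fin n ⊕ Fin (n + 1)) :
    (graphMap hQ).comp (dropW n k) = X k := by
  rcases k with k | k
  · exact Fin.lastCases_castSucc (motive := fun _ => MvPowerSeries (Fin n ⊕ Fin (n + 1)) ℂ) k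
  · rfl

@[simp]
theorem graphMap_comp_last : (graphMap hQ).comp (Sum.inl (Fin.last n)) = Q :=
  Fin.lastCases_last (motive := fun _ => MvPowerSeries (Fin n ⊕ Fin (n + 1)) ℂ)

@[simp]
theorem graphMap_rename_dropW (f : MvPowerSeries (Fin n ⊕ Fin (n + 1)) ℂ) :
    (graphMap hQ).pullHom (rename (dropW n) f) = f := by
  rw [FormalMap.pullHom_rename]
  simp only [graphMap_comp_dropW]
  exact congrFun subst_self f

@[simp]
theorem graphMap_graphSeries : (graphMap hQ).pullHom (graphSeries Q) = 0 := by
  rw [graphSeries_eq, map_sub, graphMap_rename_dropW, FormalMap.pullHom_X, graphMap_comp_last,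
    sub_self]

@[simp]
theorem graphMap_rename_inr (f : MvPowerSeries (Fin (n + 1)) ℂ) :
    (graphMap hQ).pullHom (rename Sum.inr f) = rename Sum.inr f := by
  rw [FormalMap.pullHom_rename, rename_eq_subst]
  rfl

/-- In the chain rule only w = Q depends nontrivially on the parameters, which yields the second
summand. -/
theorem pderiv_graphMap (h : MvPowerSeries (Fin (n + 1) ⊕ Fin (n + 1)) ℂ)
    (k : Fin n ⊕ Fin (n + 1)) :
    pderiv ℂ k ((graphMap hQ).pullHom h) =
      (graphMap hQ).pullHom (pderiv ℂ (dropW n k) h) +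
        (graphMap hQ).pullHom (pderiv ℂ (Sum.inl (Fin.last n)) h) * pderiv ℂ k Q := by
  classical
  have hsum : ∀ F : Fin (n + 1) ⊕ Fin (n + 1) → MvPowerSeries (Fin n ⊕ Fin (n + 1)) ℂ,
      ∑ j, F j = ∑ j, F (dropW n j) + F (Sum.inl (Fin.last n)) := by
    intro F
    rw [Fintype.sum_sum_type, Fintype.sum_sum_type, Fin.sum_univ_castSucc]
    exact add_right_comm _ _ _
  rw [FormalMap.pderiv_pullHom, hsum, graphMap_comp_last]
  congr 1
  rw [Finset.sum_eq_single k]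
  · simp
  · intro j _ hj
    rw [graphMap_comp_dropW, pderiv_X_of_ne hj, mul_zero]
  · simp

end graphMap

namespace IsNondegenerateNormal

theorem constantCoeff_eq_zero (hQ : IsNondegenerateNormal Q) : constantCoeff Q = 0 := by
  rw [← constantCoeff_killCompl .inl, hQ.killCompl_inl, map_zero]

theorem killCompl_dropTau_rename_inr (f : MvPowerSeries (Fin (n + 1)) ℂ) :
    killCompl (dropTau n) (rename Sum.inr f) = rename Sum.inr (killCompl Fin.castSuccEmb f) := by
  rw [rename_eq_subst, killCompl_eq_subst, subst_comp_subst_apply (HasSubst.X_comp _)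
    (hasSubst_killCompl_X _), rename_eq_subst, killCompl_eq_subst Fin.castSuccEmb,
    subst_comp_subst_apply (hasSubst_killCompl_X _) (HasSubst.X_comp _)]
  congr 1
  funext j
  rw [Function.comp_apply, subst_X (hasSubst_killCompl_X _)]
  refine Fin.lastCases ?_ (fun i => ?_) j
  · rw [killCompl_X_eq_zero, killCompl_X_eq_zero]
    · rw [← coe_substAlgHom (HasSubst.X_comp _), map_zero]
    · rintro ⟨i, hi⟩
      exact (Fin.castSucc_lt_last i).ne hi
    · rintro ⟨i | i, hi⟩
      · exact nomatch hi
      · exact (Fin.castSucc_lt_last i).ne (Sum.inr_injective hi)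
  · have h1 := killCompl_X (R := ℂ) (e := dropTau n) (Sum.inr i)
    have h2 := killCompl_X (R := ℂ) (e := (Fin.castSuccEmb : Fin n ↪ Fin (n + 1))) i
    rw [dropTau_inr] at h1
    rw [Fin.coe_castSuccEmb] at h2
    rw [h1, h2, subst_X (HasSubst.X_comp _)]
    rfl

/-- The complex covectors `∂_ζ Q(z, χ, 0)` span: they are annihilated by no nonzero vector
depending on `χ` only. -/
theorem eq_zero_of_sum_dropTau (hQ : IsNondegenerateNormal Q)
    (c : Fin (n + 1) → MvPowerSeries (Fin n) ℂ)
    (hc : ∑ i, rename Sum.inr (c i) * killCompl (dropTau n) (pderiv ℂ (Sum.inr i) Q) = 0) :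
    c = 0 := by
  classical
  -- Since Q(0, χ, τ) = τ, the ζ-gradient of Q at z = 0 is the last basis vector; this isolates the
  -- τ-component of c.
  have hpd : ∀ i, killCompl .inr (killCompl (dropTau n) (pderiv ℂ (Sum.inr i) Q)) =
      if i = Fin.last n then (1 : MvPowerSeries (Fin n) ℂ) else 0 := by
    intro i
    have h1 : killCompl .inr (killCompl (dropTau n) (pderiv ℂ (Sum.inr i) Q)) =
        killCompl Fin.castSuccEmb
          (killCompl (.inr : Fin (n + 1) ↪ Fin n ⊕ Fin (n + 1)) (pderiv ℂ (Sum.inr i) Q)) := by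
      rw [killCompl_killCompl, killCompl_killCompl]
      rfl
    have h2 := pderiv_killCompl (.inr : Fin (n + 1) ↪ Fin n ⊕ Fin (n + 1)) Q i
    rw [hQ.killCompl_inr, pderiv_X] at h2
    rw [h1, ← Function.Embedding.inr_apply, ← h2, Pi.single_apply]
    simp only [eq_comm, apply_ite (killCompl Fin.castSuccEmb), map_one, map_zero]
  have hlast : c (Fin.last n) = 0 := by
    have := congrArg (killCompl .inr) hc
    simpa [hpd] using this
  have hinit : (fun i : Fin n => c i.castSucc) = 0 := by
    refine hQ.eq_zero _ ?_
    rw [Fin.sum_univ_castSucc, hlast, map_zero, zero_mul, add_zero] at hc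
    simpa only [pderiv_killCompl, dropTau_inr] using hc
  funext i
  refine Fin.lastCases hlast (fun i => ?_) i
  exact congrFun hinit i

theorem X_dvd_of_killCompl_eq_zero {f : MvPowerSeries (Fin (n + 1)) ℂ}
    (hf : killCompl Fin.castSuccEmb f = 0) : X (Fin.last n) ∣ f := by
  rw [X_dvd_iff]
  intro m hm
  have hm' : m ∈ Set.range (Finsupp.embDomain Fin.castSuccEmb) := by
    rw [Finsupp.mem_range_embDomain_iff]
    intro k hk
    refine Fin.lastCases (fun hk => ?_) (fun i _ => ⟨i, rfl⟩) k hk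
    exact absurd hm (Finsupp.mem_support_iff.mp hk)
  obtain ⟨x, rfl⟩ := hm'
  rw [← coeff_killCompl, hf, map_zero]

/-- The complex covectors `∂_ζ Q(z, ζ)` span: they are annihilated by no nonzero vector
depending on `ζ` only. -/
theorem eq_zero_of_sum (hQ : IsNondegenerateNormal Q)
    (c : Fin (n + 1) → MvPowerSeries (Fin (n + 1)) ℂ)
    (hc : ∑ i, rename Sum.inr (c i) * pderiv ℂ (Sum.inr i) Q = 0) : c = 0 := by
  -- Restricting to τ = 0 shows that every c_i is divisible by τ. The quotients satisfy the same
  -- relation, so the c_i are divisible by all powers of τ.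
  suffices h : ∀ m : ℕ, ∀ c : Fin (n + 1) → MvPowerSeries (Fin (n + 1)) ℂ,
      ∑ i, rename Sum.inr (c i) * pderiv ℂ (Sum.inr i) Q = 0 →
      ∀ i, (X (Fin.last n) : MvPowerSeries (Fin (n + 1)) ℂ) ^ m ∣ c i by
    funext i
    ext d
    exact X_pow_dvd_iff.mp (h (d (Fin.last n) + 1) c hc i) d (Nat.lt_succ_self _)
  intro m
  induction m with
  | zero => simp
  | succ m ih =>
    intro c hc
    have h0 := hQ.eq_zero_of_sum_dropTau (fun i => killCompl Fin.castSuccEmb (c i)) (by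
      have := congrArg (killCompl (dropTau n)) hc
      simpa only [map_sum, map_mul, killCompl_dropTau_rename_inr, map_zero] using this)
    choose d hd using fun i => X_dvd_of_killCompl_eq_zero (congrFun h0 i)
    have hd' : ∑ i, rename Sum.inr (d i) * pderiv ℂ (Sum.inr i) Q = 0 := by
      simp only [hd, map_mul, mul_assoc, ← Finset.mul_sum] at hc
      refine (mul_eq_zero.mp hc).resolve_left ?_
      rw [rename_X]
      intro h
      have := pderiv_X_self (R := ℂ) (i := (Sum.inr (Fin.last n) : Fin n ⊕ Fin (n + 1)))
      rw [h, map_zero] at this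
      exact zero_ne_one this
    intro i
    rw [hd i, pow_succ']
    exact mul_dvd_mul_left _ (ih d hd' i)

end IsNondegenerateNormal
end FormalCR

/-! ### Annihilating vector fields and restriction to τ = 0. -/

namespace FormalCR

variable {n : ℕ} {Q : MvPowerSeries (Fin n ⊕ Fin (n + 1)) ℂ}

namespace IsNondegenerateNormal

/-- A series vanishing on the hypersurface `w = Q(z, ζ)` and annihilated by a nonzero vector field
in `ζ` with coefficients depending on `ζ` only is zero. -/
theorem eq_zero_of_vectorField (hQ : IsNondegenerateNormal Q)
    {f : MvPowerSeries (Fin (n + 1) ⊕ Fin (n + 1)) ℂ}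
    (hf : (graphMap hQ.constantCoeff_eq_zero).pullHom f = 0)
    {c : Fin (n + 1) → MvPowerSeries (Fin (n + 1)) ℂ} (hc : c ≠ 0)
    (hcf : ∑ i, rename Sum.inr (c i) * pderiv ℂ (Sum.inr i) f = 0) : f = 0 := by
  set Γ := (graphMap hQ.constantCoeff_eq_zero).pullHom with hΓ
  set D := pderiv ℂ (Sum.inl (Fin.last n) : Fin (n + 1) ⊕ Fin (n + 1)) with hD
  have hW : ∑ i, rename Sum.inr (c i) * pderiv ℂ (Sum.inr i) Q ≠ 0 := fun h =>
    hc (hQ.eq_zero_of_sum c h)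
  -- Differentiating Γ h = 0 gives Γ(h_{ζ_i}) = -Γ(h_w) Q_{ζ_i}. Weighting with c turns this into
  -- Γ(h_w) · ∑ c_i Q_{ζ_i} = 0, whose second factor is nonzero. The field commutes with ∂_w because
  -- c depends on ζ only, so the step iterates.
  have step : ∀ h, Γ h = 0 → ∑ i, rename Sum.inr (c i) * pderiv ℂ (Sum.inr i) h = 0 →
      Γ (D h) = 0 ∧ ∑ i, rename Sum.inr (c i) * pderiv ℂ (Sum.inr i) (D h) = 0 := by
    intro h h0 hX
    constructor
    · have h1 : ∀ i, Γ (pderiv ℂ (Sum.inr i) h) = -(Γ (D h) * pderiv ℂ (Sum.inr i) Q) := by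
        intro i
        have := pderiv_graphMap hQ.constantCoeff_eq_zero h (Sum.inr i)
        rw [← hΓ, h0, map_zero] at this
        exact eq_neg_of_add_eq_zero_left this.symm
      have h2 := congrArg Γ hX
      simp only [map_sum, map_mul, h1, map_zero] at h2
      rw [hΓ] at h2
      simp only [graphMap_rename_inr] at h2
      rw [← hΓ] at h2
      have h3 : Γ (D h) * ∑ i, rename Sum.inr (c i) * pderiv ℂ (Sum.inr i) Q = 0 := by
        rw [Finset.mul_sum, ← neg_eq_zero, ← h2, ← Finset.sum_neg_distrib]
        exact Finset.sum_congr rfl fun i _ => by ring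
      exact (mul_eq_zero.mp h3).resolve_right hW
    · have h1 := congrArg D hX
      rw [map_sum, map_zero] at h1
      rw [← h1]
      refine Finset.sum_congr rfl fun i _ => ?_
      rw [Derivation.leibniz, hD, pderiv_inl_rename_inr, smul_zero, add_zero, smul_eq_mul,
        pderiv_comm]
  have hiter : ∀ k : ℕ, Γ (D^[k] f) = 0 ∧
      ∑ i, rename Sum.inr (c i) * pderiv ℂ (Sum.inr i) (D^[k] f) = 0 := by
    intro k
    induction k with
    | zero => exact ⟨hf, hcf⟩
    | succ k ih =>
      rw [Function.iterate_succ_apply']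
      exact step _ ih.1 ih.2
  -- Vanishing of all w-derivatives on w = Q is stable under every ∂_j: along w = Q the other
  -- derivatives are recovered from tangential ones and ∂_w.
  refine eq_zero_of_pderiv_closed (fun h => ∀ k : ℕ, Γ (D^[k] h) = 0) ?_ ?_ fun k => (hiter k).1
  · intro h h0
    have := h0 0
    rw [← FormalMap.constantCoeff_pullHom (graphMap hQ.constantCoeff_eq_zero), ← hΓ]
    rw [Function.iterate_zero_apply] at this
    rw [this, map_zero]
  · intro h h0 j k
    have hcomm : D^[k] (pderiv ℂ j h) = pderiv ℂ j (D^[k] h) :=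
      (Function.Commute.iterate_left (f := D) (g := pderiv ℂ j) (pderiv_comm _ _) k) h
    have hw : Γ (D (D^[k] h)) = 0 := by
      rw [← Function.iterate_succ_apply' D]; exact h0 (k + 1)
    have hdrop : ∀ l, Γ (pderiv ℂ (dropW n l) (D^[k] h)) = 0 := by
      intro l
      have := pderiv_graphMap hQ.constantCoeff_eq_zero (D^[k] h) l
      rw [← hΓ, h0 k, map_zero, hw, zero_mul, add_zero] at this
      exact this.symm
    rw [hcomm]
    rcases j with j | j
    · refine Fin.lastCases hw (fun i => ?_) j
      exact hdrop (Sum.inl i)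
    · exact hdrop (Sum.inr j)

/-- Restriction to the Segre variety part `w = Q(z, χ, 0)`, `τ = 0` of the hypersurface. -/
noncomputable def segre (hQ : IsNondegenerateNormal Q) :
    MvPowerSeries (Fin (n + 1) ⊕ Fin (n + 1)) ℂ →ₐ[ℂ] MvPowerSeries (Fin n ⊕ Fin n) ℂ :=
  (killCompl (dropTau n)).comp (graphMap hQ.constantCoeff_eq_zero).pullHom

theorem segre_apply (hQ : IsNondegenerateNormal Q)
    (f : MvPowerSeries (Fin (n + 1) ⊕ Fin (n + 1)) ℂ) :
    hQ.segre f = killCompl (dropTau n) ((graphMap hQ.constantCoeff_eq_zero).pullHom f) := rfl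

theorem constantCoeff_segre (hQ : IsNondegenerateNormal Q)
    (f : MvPowerSeries (Fin (n + 1) ⊕ Fin (n + 1)) ℂ) :
    constantCoeff (hQ.segre f) = constantCoeff f := by
  rw [segre_apply, constantCoeff_killCompl, FormalMap.constantCoeff_pullHom]

theorem segre_rename_inr (hQ : IsNondegenerateNormal Q) (f : MvPowerSeries (Fin (n + 1)) ℂ) :
    hQ.segre (rename Sum.inr f) = rename Sum.inr (killCompl Fin.castSuccEmb f) := by
  rw [segre_apply, graphMap_rename_inr, killCompl_dropTau_rename_inr]

theorem segre_graphSeries (hQ : IsNondegenerateNormal Q) : hQ.segre (graphSeries Q) = 0 := by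
  rw [segre_apply, graphMap_graphSeries, map_zero]

theorem pderiv_segre (hQ : IsNondegenerateNormal Q)
    (f : MvPowerSeries (Fin (n + 1) ⊕ Fin (n + 1)) ℂ) (k : Fin n ⊕ Fin n) :
    pderiv ℂ k (hQ.segre f) = hQ.segre (pderiv ℂ (dropW n (dropTau n k)) f) +
      hQ.segre (pderiv ℂ (Sum.inl (Fin.last n)) f) *
        pderiv ℂ k (killCompl (dropTau n) Q) := by
  rw [segre_apply, pderiv_killCompl, pderiv_graphMap, map_add, map_mul, pderiv_killCompl]
  rfl

/-- The map `(z, χ) ↦ (z, Q(z, χ, 0))` has full generic rank. -/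
theorem eq_zero_of_segre_rename_inl (hQ : IsNondegenerateNormal Q) (hn : 1 ≤ n)
    {f : MvPowerSeries (Fin (n + 1)) ℂ} (hf : hQ.segre (rename Sum.inl f) = 0) : f = 0 := by
  -- Here n ≥ 1 matters: Q(z, χ, 0) really depends on χ, as otherwise the constant field (1, …, 1)
  -- would annihilate it.
  obtain ⟨j, hj⟩ : ∃ j : Fin n, pderiv ℂ (Sum.inr j) (killCompl (dropTau n) Q) ≠ 0 := by
    by_contra! h
    have := hQ.eq_zero (fun _ => 1) (by simp [h])
    exact one_ne_zero (congrFun this ⟨0, hn⟩)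
  refine eq_zero_of_pderiv_closed (fun f => hQ.segre (rename Sum.inl f) = 0) ?_ ?_ hf
  · intro f hf
    rw [← constantCoeff_rename (Sum.inl : _ → Fin (n + 1) ⊕ Fin (n + 1)), ← hQ.constantCoeff_segre,
      hf, map_zero]
  · intro f hf i
    have hlast : hQ.segre (rename Sum.inl (pderiv ℂ (Fin.last n) f)) = 0 := by
      have := hQ.pderiv_segre (rename Sum.inl f) (Sum.inr j)
      rw [hf, map_zero, dropTau_inr] at this
      rw [show dropW n (Sum.inr j.castSucc) = Sum.inr j.castSucc from rfl, pderiv_inr_rename_inl,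
        pderiv_inl_rename_inl, map_zero, zero_add] at this
      exact (mul_eq_zero.mp this.symm).resolve_right hj
    refine Fin.lastCases hlast (fun i => ?_) i
    have := hQ.pderiv_segre (rename Sum.inl f) (Sum.inl i)
    rw [hf, map_zero, dropTau_inl] at this
    rw [show dropW n (Sum.inl i) = Sum.inl i.castSucc from rfl, pderiv_inl_rename_inl,
      pderiv_inl_rename_inl, hlast, zero_mul, add_zero] at this
    exact this.symm

/-- Q(z, 0, 0) = 0, so at χ = 0 the point (z, Q(z, χ, 0)) becomes (z, 0). -/
theorem killCompl_inl_segre_rename_inl (hQ : IsNondegenerateNormal Q)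
    (f : MvPowerSeries (Fin (n + 1)) ℂ) :
    killCompl .inl (hQ.segre (rename Sum.inl f)) = killCompl Fin.castSuccEmb f := by
  have htrans : (Function.Embedding.inl : Fin n ↪ Fin n ⊕ Fin n).trans (dropTau n) = .inl := rfl
  rw [segre_apply, killCompl_killCompl, htrans, FormalMap.pullHom_rename]
  refine killCompl_subst Fin.castSuccEmb _ ?_ ?_ f
  · exact hasSubst_of_constantCoeff_zero fun k => FormalMap.constantCoeff_comp _ _
  · intro t
    refine Fin.lastCases ?_ (fun i => ?_) t
    · rw [graphMap_comp_last, hQ.killCompl_inl, killCompl_X_eq_zero]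
      rintro ⟨i, hi⟩
      exact (Fin.castSucc_lt_last i).ne hi
    · rw [show (Sum.inl i.castSucc : Fin (n + 1) ⊕ Fin (n + 1)) = dropW n (Sum.inl i) from rfl,
        graphMap_comp_dropW]
      exact (killCompl_X (e := .inl) i).trans (killCompl_X (e := Fin.castSuccEmb) i).symm

end IsNondegenerateNormal

section Pullback

variable {N : ℕ} (H : FormalMap (Fin N) (Fin N)) (h : MvPowerSeries (Fin N ⊕ Fin N) ℂ)

theorem pderiv_inl_doubled_pullHom (i : Fin N) :
    pderiv ℂ (Sum.inl i) (H.doubled.pullHom h) =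
      ∑ j, H.doubled.pullHom (pderiv ℂ (Sum.inl j) h) * rename Sum.inl (H.jacobian j i) := by
  rw [FormalMap.pderiv_pullHom, Fintype.sum_sum_type]
  simp only [FormalMap.doubled, Sum.elim_inl, Sum.elim_inr, pderiv_inl_rename_inl,
    pderiv_inl_rename_inr, mul_zero, Finset.sum_const_zero, add_zero]
  rfl

theorem pderiv_inr_doubled_pullHom (i : Fin N) :
    pderiv ℂ (Sum.inr i) (H.doubled.pullHom h) =
      ∑ j, H.doubled.pullHom (pderiv ℂ (Sum.inr j) h) * rename Sum.inr (H.conj.jacobian j i) := by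
  rw [FormalMap.pderiv_pullHom, Fintype.sum_sum_type]
  simp only [FormalMap.doubled, Sum.elim_inl, Sum.elim_inr, pderiv_inr_rename_inr,
    pderiv_inr_rename_inl, mul_zero, Finset.sum_const_zero, zero_add]
  rfl

end Pullback

/-- By the reality of `M.r`, its ζ-gradient at 0 is nonzero along with its Z-gradient. -/
theorem FormalHypersurface.constantCoeff_pderiv_inr {N : ℕ} (M : FormalHypersurface N)
    (i : Fin N) : constantCoeff (pderiv ℂ (Sum.inr i) M.r) =
      starRingEnd ℂ (constantCoeff (pderiv ℂ (Sum.inl i) M.r)) := by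
  have h := pderiv_rename (Equiv.sumComm (Fin N) (Fin N)).toEmbedding (conjSeries M.r) (Sum.inl i)
  have h' : rename (Equiv.sumComm (Fin N) (Fin N)).toEmbedding (conjSeries M.r) = M.r :=
    M.invariant
  rw [h'] at h
  have h2 := congrArg constantCoeff h
  rw [constantCoeff_rename, conjSeries, ← map_pderiv, constantCoeff_map] at h2
  exact h2

end FormalCR

/-! ### The two cases: degenerate and nondegenerate Jacobian. -/

namespace FormalCR

variable {n : ℕ} {Q : MvPowerSeries (Fin n ⊕ Fin (n + 1)) ℂ}

namespace IsNondegenerateNormal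

/-- If the Jacobian determinant of `H` vanishes, then `r'(H(Z), H̄(ζ))` vanishes identically. -/
theorem pullHom_eq_zero_of_det_jacobian_eq_zero (hQ : IsNondegenerateNormal Q)
    {H : FormalMap (Fin (n + 1)) (Fin (n + 1))}
    {r a : MvPowerSeries (Fin (n + 1) ⊕ Fin (n + 1)) ℂ}
    (ha : H.doubled.pullHom r = a * graphSeries Q) (hJ : H.jacobian.det = 0) :
    H.doubled.pullHom r = 0 := by
  have hJ' : H.conj.jacobian.det = 0 := by
    rw [FormalMap.det_jacobian_conj, hJ, conjSeries, map_zero]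
  -- The field ∑ c_i(ζ) ∂_{ζ_i} annihilates every component of H̄, hence anything composed with
  -- (H(Z), H̄(ζ)).
  obtain ⟨c, hc, hc0⟩ := Matrix.exists_mulVec_eq_zero_iff.mpr hJ'
  refine hQ.eq_zero_of_vectorField ?_ hc ?_
  · rw [ha, map_mul, graphMap_graphSeries, mul_zero]
  · simp only [pderiv_inr_doubled_pullHom, Finset.mul_sum]
    rw [Finset.sum_comm]
    refine Finset.sum_eq_zero fun j _ => ?_
    have h := congrArg (rename (Sum.inr : _ → Fin (n + 1) ⊕ Fin (n + 1))) (congrFun hc0 j)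
    rw [Matrix.mulVec, dotProduct, map_sum, Pi.zero_apply, map_zero] at h
    rw [← mul_zero (H.doubled.pullHom (pderiv ℂ (Sum.inr j) r)), ← h, Finset.mul_sum]
    refine Finset.sum_congr rfl fun i _ => ?_
    rw [map_mul]
    ring

/-- The transversality factor does not vanish at the origin if the Jacobian determinant of `H` is
not identically zero. -/
theorem constantCoeff_ne_zero_of_det_jacobian_ne_zero (hQ : IsNondegenerateNormal Q) (hn : 1 ≤ n)
    {H : FormalMap (Fin (n + 1)) (Fin (n + 1))} {M' : FormalHypersurface (n + 1)}
    {a : MvPowerSeries (Fin (n + 1) ⊕ Fin (n + 1)) ℂ}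
    (ha : H.doubled.pullHom M'.r = a * graphSeries Q) (hJ : H.jacobian.det ≠ 0) :
    constantCoeff a ≠ 0 := by
  obtain ⟨j₀, hj₀⟩ := M'.gradient_ne_zero
  -- `P` and `P'` are the two gradients of r' along H, restricted to τ = 0, w = Q(z, χ, 0); their
  -- entries at `j₀` are units.
  let P : Fin (n + 1) → MvPowerSeries (Fin n ⊕ Fin n) ℂ := fun j =>
    hQ.segre (H.doubled.pullHom (pderiv ℂ (Sum.inl j) M'.r))
  let P' : Fin (n + 1) → MvPowerSeries (Fin n ⊕ Fin n) ℂ := fun j =>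
    hQ.segre (H.doubled.pullHom (pderiv ℂ (Sum.inr j) M'.r))
  have hP : constantCoeff (P j₀) ≠ 0 := by
    rwa [hQ.constantCoeff_segre, FormalMap.constantCoeff_pullHom]
  have hP' : constantCoeff (P' j₀) ≠ 0 := by
    rw [hQ.constantCoeff_segre, FormalMap.constantCoeff_pullHom, M'.constantCoeff_pderiv_inr]
    exact (map_ne_zero _).mpr hj₀
  have hderiv : ∀ k, hQ.segre (pderiv ℂ k (H.doubled.pullHom M'.r)) =
      hQ.segre a * hQ.segre (pderiv ℂ k (graphSeries Q)) := by
    intro k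
    rw [ha, Derivation.leibniz, map_add, smul_eq_mul, smul_eq_mul, map_mul, map_mul,
      hQ.segre_graphSeries, zero_mul, add_zero]
  let B : Matrix (Fin (n + 1)) (Fin (n + 1)) (MvPowerSeries (Fin n ⊕ Fin n) ℂ) :=
    (hQ.segre.comp (rename Sum.inl)).mapMatrix H.jacobian
  let B' : Matrix (Fin (n + 1)) (Fin (n + 1)) (MvPowerSeries (Fin n) ℂ) :=
    (killCompl Fin.castSuccEmb).mapMatrix H.conj.jacobian
  let B'' : Matrix (Fin (n + 1)) (Fin (n + 1)) (MvPowerSeries (Fin n ⊕ Fin n) ℂ) :=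
    (rename Sum.inr).mapMatrix B'
  let g : Fin (n + 1) → MvPowerSeries (Fin n ⊕ Fin n) ℂ := fun i =>
    hQ.segre (pderiv ℂ (Sum.inl i) (graphSeries Q))
  let g' : Fin (n + 1) → MvPowerSeries (Fin n ⊕ Fin n) ℂ := fun i =>
    hQ.segre (pderiv ℂ (Sum.inr i) (graphSeries Q))
  have hPB : Matrix.vecMul P B = hQ.segre a • g := by
    funext i
    have h := hderiv (Sum.inl i)
    rw [pderiv_inl_doubled_pullHom, map_sum] at h
    simp only [map_mul] at h
    exact h
  have hPB' : Matrix.vecMul P' B'' = hQ.segre a • g' := by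
    funext i
    have h := hderiv (Sum.inr i)
    rw [pderiv_inr_doubled_pullHom, map_sum] at h
    simp only [map_mul, hQ.segre_rename_inr] at h
    exact h
  have hg' : ∀ i, g' i = -killCompl (dropTau n) (pderiv ℂ (Sum.inr i) Q) := by
    intro i
    have h := pderiv_graphSeries_dropW Q (Sum.inr i)
    change hQ.segre (pderiv ℂ (dropW n (Sum.inr i)) (graphSeries Q)) = _
    rw [h, map_neg, hQ.segre_apply, graphMap_rename_dropW]
  -- If a vanished there, `P` would be a left kernel vector of `B`, whose determinant is nonzero
  -- because (z, χ) ↦ (z, Q(z, χ, 0)) has full generic rank.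
  have ha0 : hQ.segre a ≠ 0 := by
    intro h0
    rw [h0, zero_smul] at hPB
    have hdet : B.det ≠ 0 := by
      rw [← AlgHom.map_det]
      exact fun h => hJ (hQ.eq_zero_of_segre_rename_inl hn h)
    have := congrFun (Matrix.eq_zero_of_vecMul_eq_zero hdet hPB) j₀
    rw [this] at hP
    exact hP (map_zero _)
  -- A kernel vector c(χ) of `B'` satisfies a · (g' · c) = 0, hence g' · c = 0, contrary to class 𝒞.
  have hdetB' : B'.det ≠ 0 := by
    intro h0
    obtain ⟨c, hc, hc0⟩ := Matrix.exists_mulVec_eq_zero_iff.mpr h0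
    apply hc
    refine hQ.eq_zero_of_sum_dropTau c ?_
    have h1 : Matrix.mulVec B'' (fun i => rename Sum.inr (c i)) = 0 := by
      funext j
      have := congrArg (rename (Sum.inr : _ → Fin n ⊕ Fin n)) (congrFun hc0 j)
      rw [Matrix.mulVec, dotProduct, map_sum, Pi.zero_apply, map_zero] at this
      simp only [map_mul] at this
      exact this
    have h2 := Matrix.dotProduct_mulVec P' B'' (fun i => rename Sum.inr (c i))
    rw [h1, dotProduct_zero, hPB', smul_dotProduct, smul_eq_mul] at h2
    have h3 := (mul_eq_zero.mp h2.symm).resolve_left ha0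
    rw [dotProduct] at h3
    rw [← neg_eq_zero, ← h3, ← Finset.sum_neg_distrib]
    refine Finset.sum_congr rfl fun i _ => ?_
    rw [hg']
    ring
  have hdetB0 : killCompl (Fin.castSuccEmb : Fin n ↪ _) H.jacobian.det ≠ 0 := by
    intro h0
    apply hdetB'
    rw [← AlgHom.map_det, FormalMap.det_jacobian_conj, conjSeries, killCompl_map, h0, map_zero]
  -- At χ = 0 the matrix `B` becomes ∂H(z, 0), invertible over the fraction field by `hdetB0`, so
  -- a(z, 0) = 0 would force `P` to vanish at χ = 0.
  have ha1 : killCompl .inl (hQ.segre a) ≠ 0 := by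
    intro h0
    have hv : Matrix.vecMul (fun j => killCompl .inl (P j))
        ((killCompl (Fin.castSuccEmb : Fin n ↪ _)).mapMatrix H.jacobian) = 0 := by
      funext i
      have := congrArg (killCompl .inl) (congrFun hPB i)
      rw [Pi.smul_apply, smul_eq_mul, map_mul, h0, zero_mul, Matrix.vecMul, dotProduct,
        map_sum] at this
      rw [Pi.zero_apply, ← this, Matrix.vecMul, dotProduct]
      refine Finset.sum_congr rfl fun j _ => ?_
      rw [map_mul]
      congr 1
      exact (hQ.killCompl_inl_segre_rename_inl (H.jacobian j i)).symm
    have := congrFun (Matrix.eq_zero_of_vecMul_eq_zero (by rwa [← AlgHom.map_det]) hv) j₀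
    rw [← constantCoeff_killCompl .inl, this] at hP
    exact hP (map_zero _)
  rw [← hQ.constantCoeff_segre]
  refine constantCoeff_ne_zero_of_mul_eq_rename hdetB' hP' ha1
    (g := Matrix.vecMul g' B''.adjugate j₀) ?_
  -- Multiplying by the adjugate gives a · (g' adj `B''`)_{j₀} = P'_{j₀} · det `B''`, where `B''`
  -- involves χ only.
  have h1 := congrArg (fun v => Matrix.vecMul v B''.adjugate j₀) hPB'
  simp only [Matrix.vecMul_vecMul, Matrix.mul_adjugate, Matrix.smul_vecMul, Matrix.vecMul_smul,
    Matrix.vecMul_one, Pi.smul_apply, smul_eq_mul] at h1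
  rw [← h1, mul_comm, AlgHom.map_det]

end IsNondegenerateNormal

/-! ### Return to the original coordinates. -/

/-- A vector in the image of `dH` that is not in `T^{1,0}_0 M'` witnesses CR-transversality. -/
theorem isCRTransversal_of_ne_zero {N : ℕ} {H : FormalMap (Fin N) (Fin N)}
    {M' : FormalHypersurface N} (v : Fin N → ℂ)
    (hv : ∑ j, constantCoeff (pderiv ℂ (Sum.inl j) M'.r) * (H.diffZero.mulVec v) j ≠ 0) :
    IsCRTransversal H M' := by
  set l : (Fin N → ℂ) →ₗ[ℂ] ℂ := ∑ i : Fin N,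
    constantCoeff (pderiv ℂ (Sum.inl i) M'.r) • (LinearMap.proj i : (Fin N → ℂ) →ₗ[ℂ] ℂ) with hl
  have hlv : l (H.diffZero.mulVec v) ≠ 0 := by
    simpa [hl, LinearMap.sum_apply] using hv
  rw [IsCRTransversal, eq_top_iff]
  intro x _
  refine Submodule.mem_sup.mpr ⟨x - (l x / l (H.diffZero.mulVec v)) • H.diffZero.mulVec v, ?_,
    (l x / l (H.diffZero.mulVec v)) • H.diffZero.mulVec v, ?_, sub_add_cancel _ _⟩
  · change l _ = 0
    rw [map_sub, map_smul, smul_eq_mul, div_mul_cancel₀ _ hlv, sub_self]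
  · exact Submodule.smul_mem _ _ ⟨v, rfl⟩

/-- Transversality of `H ∘ Φ` in normal coordinates gives transversality of `H`. -/
theorem isCRTransversal_of_constantCoeff_ne_zero (hQ : constantCoeff Q = 0)
    {H Φ : FormalMap (Fin (n + 1)) (Fin (n + 1))} {M' : FormalHypersurface (n + 1)}
    {a : MvPowerSeries (Fin (n + 1) ⊕ Fin (n + 1)) ℂ}
    (ha : (H.after Φ).doubled.pullHom M'.r = a * graphSeries Q) (ha0 : constantCoeff a ≠ 0) :
    IsCRTransversal H M' := by
  -- The witness is the image of ∂_w under dΦ: the w-derivative of a ρ at 0 is a(0), since ρ(0) = 0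
  -- and ρ_w = 1.
  refine isCRTransversal_of_ne_zero (fun i => Φ.diffZero i (Fin.last n)) ?_
  have hρ : constantCoeff (graphSeries Q) = 0 := by
    rw [graphSeries_eq, map_sub, constantCoeff_rename, hQ, constantCoeff_X, sub_zero]
  have h := congrArg (fun f => constantCoeff (pderiv ℂ (Sum.inl (Fin.last n)) f)) ha
  simp only [pderiv_inl_doubled_pullHom, map_sum, map_mul, FormalMap.constantCoeff_pullHom,
    constantCoeff_rename, Derivation.leibniz, smul_eq_mul, map_add, hρ, zero_mul, add_zero,
    pderiv_graphSeries_inl_last, mul_one] at h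
  rw [← h] at ha0
  convert ha0 using 3 with j
  have := congrFun (congrFun (H.diffZero_after Φ) j) (Fin.last n)
  exact this.symm

theorem mem_span_pullHom_after {N : ℕ} {M M' : FormalHypersurface N}
    {H : FormalMap (Fin N) (Fin N)} (hH : SendsInto H M M') (Φ : FormalMap (Fin N) (Fin N)) :
    (H.after Φ).doubled.pullHom M'.r ∈ Ideal.span {Φ.doubled.pull M.r} := by
  have h1 : H.doubled.pullHom M'.r ∈ Ideal.span {M.r} := by
    rw [FormalMap.pullHom_apply]
    exact hH (Ideal.mem_span_singleton_self _)
  rw [Ideal.mem_span_singleton] at h1 ⊢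
  rw [FormalMap.doubled_after, FormalMap.pullHom_after, ← FormalMap.pullHom_apply]
  exact map_dvd _ h1

theorem isConstant_of_isConstant_after {N : ℕ} {H Φ : FormalMap (Fin N) (Fin N)}
    (hΦ : Φ.diffZero.det ≠ 0) (h : (H.after Φ).IsConstant) : H.IsConstant := by
  rw [FormalMap.isConstant_iff] at h ⊢
  exact fun j => Φ.pullHom_injective_of_det_ne_zero hΦ (h j)

end FormalCR

theorem corollary2p4 (n : ℕ) (hn : 1 ≤ n) (M M' : FormalCR.FormalHypersurface (n + 1))
    (hM : FormalCR.InClassC M) (hM' : ¬ M'.ContainsFormalCurve)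
    (H : FormalCR.FormalMap (Fin (n + 1)) (Fin (n + 1)))
    (hH : FormalCR.SendsInto H M M') :
    H.IsConstant ∨ FormalCR.IsCRTransversal H M' := by
  obtain ⟨Φ, Q, hΦ, hQ⟩ := FormalCR.exists_isNondegenerateNormal hM
  obtain ⟨a, ha⟩ := Ideal.mem_span_singleton'.mp
    (hΦ.ideal_eq ▸ FormalCR.mem_span_pullHom_after hH Φ)
  by_cases hJ : (H.after Φ).jacobian.det = 0
  · refine .inl (FormalCR.isConstant_of_isConstant_after hΦ.det_ne_zero ?_)
    by_contra hc
    exact hM' (M'.containsFormalCurve_of_pullHom_eq_zero _ hc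
      (hQ.pullHom_eq_zero_of_det_jacobian_eq_zero ha.symm hJ))
  · exact .inr (FormalCR.isCRTransversal_of_constantCoeff_ne_zero hQ.constantCoeff_eq_zero ha.symm
      (hQ.constantCoeff_ne_zero_of_det_jacobian_ne_zero hn ha.symm hJ))
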